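/- Let $(W,S)$ be a finite Coxeter system with length function $\ell$, sign character $\epsilon(w)=(-1)^{\ell(w)}$, reflection representation $V=\mathbb{R}^{S}$ (a Euclidean space) and set of reflections $T$. Write $x^w=w^{-1}xw$. For $L\subseteq S$ let $W_L=\langle L\rangle$, let $\operatorname{Fix}(W_L)\subseteq V$ be its fixed space, and for $w\in N_W(W_L)$ put $\alpha_L(w)=\det(w|_{\operatorname{Fix}(W_L)})$. An element $w\in W_L$ is cuspidal in $W_L$ if it has no nonzero fixed vector in the orthogonal complement of $\operatorname{Fix}(W_L)$; let $\mathcal{C}_L$ be the set of conjugacy classes of $W_L$ consisting of cuspidal elements, and for each $C\in\mathcal{C}_L$ let $w_C\in C$ be an arbitrary fixed representative. For $J\subseteq S$ let $X_J=\{w\in W:\ell(sw)>\ell(w)\text{ for all }s\in J\}$, and let $N_L=\{x\in X_L: L^x=L\}$, so that $N_W(W_L)=W_L\rtimes N_L$. In the Coxeter group $W_L$, for $J,K\subseteq L$, put $X_K^L=X_K\cap W_L$, $x_K=\sum_{x\in X_K^L}x^{-1}\in\mathbb{C}W_L$, $m_{KJ}=|\{x\in X_K^L\cap X_J^L: J^x\subseteq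 L\}|$ if $J\subseteq K$ and $m_{KJ}=0$ otherwise, and define $(e_K)_{K\subseteq L}$ by the triangular system $x_K=\sum_{J\subseteq L}m_{KJ}e_J$. The top component of $\mathbb{C}W_L$ is the right ideal $e_L\mathbb{C}W_L$; its character is denoted $\Phi_L$. Let $\widetilde\Phi_L$ be the character of $N_W(W_L)$ extending $\Phi_L$ that is afforded by $e_L\mathbb{C}W_L$ with $u\in W_L$ acting by right multiplication and $n\in N_L$ acting by $v\mapsto n^{-1}vn$; equivalently, the character of the right ideal of $\mathbb{C}N_W(W_L)$ generated by $\bigl(\sum_{n\in N_L}n\bigr)e_L$. For $t\in T$ let $H_t\subseteq V$ be the reflecting hyperplane of $t$. The Orlik--Solomon algebra $A(W)$ is the associative $\mathbb{C}$-algebra generated by $a_t$, $t\in T$, subject to $a_ta_{t'}=-a_{t'}a_t$ for all $t,t'\in T$ and $\sum_{i=1}^p(-1)^i a_{t_1}\cdots\widehat{a_{t_i}}\cdots a_{t_p}=0$ whenever $H_{t_1},\dots,H_{t_p}$ are linearly dependent, with $W$ acting by $a_t.w=a_{t^w}$. For $X=\operatorname{Fix}(W_L)$, of codimension $p$ in $V$,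 the span $A_X$ of all products $a_{t_1}\cdots a_{t_p}$ with $H_{t_1}\cap\dots\cap H_{t_p}=X$ is stable under $N_W(W_L)$; let $\widetilde\Psi_L$ be the character of $N_W(W_L)$ on $A_X$. It extends the character $\Psi_L$ of the top component of $A(W_L)$. **Theorem.** Let $L\subseteq S$ with $|L|\le 1$. Then $C_W(w_C)\subseteq N_W(W_L)$ for each $C\in\mathcal{C}_L$, and there exist linear characters $\widetilde\varphi_{w_C}$ and $\widetilde\psi_{w_C}$ of $C_W(w_C)$, $C\in\mathcal{C}_L$, such that 1. $\widetilde\Phi_L=\sum_{C\in\mathcal{C}_L}\operatorname{Ind}_{C_W(w_C)}^{N_W(W_L)}\widetilde\varphi_{w_C}$; 2. $\widetilde\Psi_L=\sum_{C\in\mathcal{C}_L}\operatorname{Ind}_{C_W(w_C)}^{N_W(W_L)}\widetilde\psi_{w_C}$; 3. $\widetilde\psi_{w_C}=\widetilde\varphi_{w_C}\,\epsilon\,\alpha_L$ on $C_W(w_C)$ for all $C\in\mathcal{C}_L$. -/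

import Mathlib

noncomputable section

open scoped Classical

namespace CoxeterSystem

/-! ### The reflection representation -/

section Geometric

variable {B : Type*}

/-- The symmetric bilinear form on the real space with basis `α i` (`i : B`), given by
`⟨α i, α j⟩ = -cos (π / M i j)`.  (In a Coxeter matrix the entry `0` stands for `∞`, and then the
formula gives `-1`.)  If the Coxeter group is finite, this is a Euclidean inner product. -/
def reflForm (M : CoxeterMatrix B) : LinearMap.BilinForm ℝ (B →₀ ℝ) :=
  Finsupp.linearCombination ℝ fun i =>
    Finsupp.linearCombination ℝ fun j => -Real.cos (Real.pi / (M i j : ℝ))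

theorem reflForm_single (M : CoxeterMatrix B) (i j : B) :
    reflForm M (Finsupp.single i 1) (Finsupp.single j 1) = -Real.cos (Real.pi / (M i j : ℝ)) := by
  simp [reflForm]

theorem two_reflForm_self (M : CoxeterMatrix B) (i : B) :
    ((2 : ℝ) • reflForm M (Finsupp.single i 1)) (Finsupp.single i 1) = 2 := by
  simp [reflForm_single]

/-- The reflection `v ↦ v - 2 ⟨α i, v⟩ α i`. -/
def simpleRefl (M : CoxeterMatrix B) (i : B) : (B →₀ ℝ) ≃ₗ[ℝ] (B →₀ ℝ) :=
  Module.reflection (two_reflForm_self M i)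

theorem chebyshev_S_eq_zero_even {k : ℕ} (hk : 2 ≤ k) :
    (Polynomial.Chebyshev.S ℝ ((k : ℤ) - 1)).eval
      (2 * Real.cos (2 * (Real.pi / ((2 * k : ℕ) : ℝ)))) = 0 := by
  have hk0 : (k : ℝ) ≠ 0 := by positivity
  have hk2 : (2 : ℝ) ≤ k := by exact_mod_cast hk
  set θ : ℝ := 2 * (Real.pi / ((2 * k : ℕ) : ℝ)) with hθ
  have hθk : k * θ = Real.pi := by rw [hθ]; push_cast; field_simp
  have hpi := Real.pi_pos
  have hs : Real.sin θ ≠ 0 := by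
    apply ne_of_gt
    apply Real.sin_pos_of_pos_of_lt_pi
    · rw [hθ]; positivity
    · nlinarith
  have h := Polynomial.Chebyshev.S_two_mul_real_cos θ ((k : ℤ) - 1)
  have h2 : (((((k : ℤ) - 1 : ℤ)) : ℝ) + 1) * θ = Real.pi := by
    push_cast; rw [← hθk]; ring
  rw [h2, Real.sin_pi] at h
  exact (mul_eq_zero.mp h).resolve_right hs

theorem chebyshev_S_add_eq_zero_odd {k : ℕ} (hk : 1 ≤ k) :
    (Polynomial.Chebyshev.S ℝ (k : ℤ)).eval
        (2 * Real.cos (2 * (Real.pi / ((2 * k + 1 : ℕ) : ℝ)))) +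
      (Polynomial.Chebyshev.S ℝ ((k : ℤ) - 1)).eval
        (2 * Real.cos (2 * (Real.pi / ((2 * k + 1 : ℕ) : ℝ)))) = 0 := by
  have hk1 : (1 : ℝ) ≤ k := by exact_mod_cast hk
  set η : ℝ := Real.pi / ((2 * k + 1 : ℕ) : ℝ) with hη
  have hηk : (2 * k + 1) * η = Real.pi := by rw [hη]; push_cast; field_simp
  have hpi := Real.pi_pos
  have hη0 : 0 < η := by rw [hη]; positivity
  have hs : Real.sin (2 * η) ≠ 0 := by
    apply ne_of_gt
    apply Real.sin_pos_of_pos_of_lt_pi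
    · positivity
    · nlinarith
  have h := Polynomial.Chebyshev.S_two_mul_real_cos (2 * η) (k : ℤ)
  have h' := Polynomial.Chebyshev.S_two_mul_real_cos (2 * η) ((k : ℤ) - 1)
  have e1 : (((k : ℤ) : ℝ) + 1) * (2 * η) = Real.pi + η := by
    push_cast; rw [← hηk]; ring
  have e2 : ((((k : ℤ) - 1 : ℤ) : ℝ) + 1) * (2 * η) = Real.pi - η := by
    push_cast; rw [← hηk]; ring
  rw [e1, add_comm, Real.sin_add_pi] at h
  rw [e2, Real.sin_pi_sub] at h'
  have : ((Polynomial.Chebyshev.S ℝ (k : ℤ)).eval (2 * Real.cos (2 * η)) +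
      (Polynomial.Chebyshev.S ℝ ((k : ℤ) - 1)).eval (2 * Real.cos (2 * η))) *
        Real.sin (2 * η) = 0 := by
    rw [add_mul, h, h']; ring
  exact (mul_eq_zero.mp this).resolve_right hs

/-- The reflections `simpleRefl M i` satisfy the Coxeter relations. -/
theorem isLiftable_simpleRefl (M : CoxeterMatrix B) : M.IsLiftable (simpleRefl M) := by
  intro i j
  by_cases hij : i = j
  · subst hij
    rw [M.diagonal, pow_one]
    ext1 v
    exact Module.involutive_reflection (two_reflForm_self M i) v
  have h1 : M i j ≠ 1 := M.off_diagonal i j hij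
  ext1 v
  have key := Module.reflection_mul_reflection_pow_apply (two_reflForm_self M i)
    (two_reflForm_self M j) (M i j) v
  have ht : ((2 : ℝ) • reflForm M (Finsupp.single i 1)) (Finsupp.single j 1) *
      ((2 : ℝ) • reflForm M (Finsupp.single j 1)) (Finsupp.single i 1) - 2 =
        2 * Real.cos (2 * (Real.pi / (M i j : ℝ))) := by
    simp only [LinearMap.smul_apply, reflForm_single, smul_eq_mul, M.symmetric j i, Real.cos_two_mul]
    ring
  rw [ht] at key
  change ((simpleRefl M i * simpleRefl M j) ^ M i j) v = v
  unfold simpleRefl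
  rw [key]
  rcases Nat.even_or_odd' (M i j) with ⟨k, hk | hk⟩
  · rcases Nat.lt_or_ge k 2 with hk2 | hk2
    · interval_cases k
      · have h0 : M i j = 0 := by simpa using hk
        simp [h0]
      · have h2 : M i j = 2 := by simpa using hk
        have h2' : M j i = 2 := by rw [M.symmetric]; exact h2
        have hc : 2 * (Real.pi / 2) = Real.pi := by ring
        have hij0 : ((2 : ℝ) • reflForm M (Finsupp.single i 1)) (Finsupp.single j 1) = 0 := by
          simp [reflForm_single, h2]
        have hji0 : ((2 : ℝ) • reflForm M (Finsupp.single j 1)) (Finsupp.single i 1) = 0 := by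
          simp [reflForm_single, h2']
        rw [hij0, hji0]
        simp only [h2, Nat.cast_ofNat, hc, Real.cos_pi]
        norm_num
        module
    · have hS := chebyshev_S_eq_zero_even hk2
      have a1 : (((M i j : ℕ) : ℤ) - 2) / 2 = (k : ℤ) - 1 := by rw [hk]; push_cast; omega
      have a2 : (((M i j : ℕ) : ℤ) - 1) / 2 = (k : ℤ) - 1 := by rw [hk]; push_cast; omega
      rw [a1, a2, hk, hS]
      simp
  · have hk1 : 1 ≤ k := by
      by_contra h
      have : k = 0 := by omega
      subst this
      exact h1 (by simpa using hk)
    have hS := chebyshev_S_add_eq_zero_odd hk1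
    have a1 : (((M i j : ℕ) : ℤ) - 1) / 2 = (k : ℤ) := by rw [hk]; push_cast; omega
    have a2 : (((M i j : ℕ) : ℤ) - 3) / 2 = (k : ℤ) - 1 := by rw [hk]; push_cast; omega
    have a3 : ((M i j : ℕ) : ℤ) / 2 = (k : ℤ) := by rw [hk]; push_cast; omega
    have a4 : (((M i j : ℕ) : ℤ) - 2) / 2 = (k : ℤ) - 1 := by rw [hk]; push_cast; omega
    rw [a1, a2, a3, a4, hk, hS]
    simp

end Geometric

variable {B W : Type*} [Group W] {M : CoxeterMatrix B} (cs : CoxeterSystem M W)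

/-- The reflection representation of `W` on the real space `V` with basis `B`. -/
def reflRep : W →* ((B →₀ ℝ) ≃ₗ[ℝ] (B →₀ ℝ)) :=
  cs.lift ⟨simpleRefl M, isLiftable_simpleRefl M⟩

/-- The sign character `ε` of `W`. -/
def signChar (w : W) : ℂ := (-1) ^ cs.length w

/-- The standard parabolic subgroup `W_L`. -/
def parabolic (L : Finset B) : Subgroup W := Subgroup.closure (cs.simple '' (L : Set B))

/-- The normalizer `N_W(W_L)`. -/
abbrev parNormalizer (L : Finset B) : Subgroup W :=
  Subgroup.normalizer (cs.parabolic L : Set W)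

/-- `Fix(P)`, the space of vectors of `V` fixed by all elements of the subgroup `P`. -/
def fixSpace (P : Subgroup W) : Submodule ℝ (B →₀ ℝ) where
  carrier := {v | ∀ w ∈ P, cs.reflRep w v = v}
  zero_mem' := fun w _ => map_zero _
  add_mem' := fun ha hb w hw => by rw [map_add, ha w hw, hb w hw]
  smul_mem' := fun c v hv w hw => by rw [map_smul, hv w hw]

theorem reflRep_mem_fixSpace {L : Finset B} {w : W} (hw : w ∈ cs.parNormalizer L) (v : B →₀ ℝ)
    (hv : v ∈ cs.fixSpace (cs.parabolic L)) :
    cs.reflRep w v ∈ cs.fixSpace (cs.parabolic L) := by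
  intro u hu
  have h : w⁻¹ * u * w ∈ cs.parabolic L :=
    (Subgroup.mem_normalizer_iff''.mp hw u).mp hu
  have h2 := hv _ h
  calc cs.reflRep u (cs.reflRep w v) = cs.reflRep w (cs.reflRep (w⁻¹ * u * w) v) := by
        rw [← LinearEquiv.mul_apply, ← LinearEquiv.mul_apply, ← map_mul, ← map_mul]
        congr 2
        group
    _ = cs.reflRep w v := by rw [h2]

/-- `α_L(w) = det(w | Fix(W_L))`, for `w` in `N_W(W_L)`. -/
def alphaChar (L : Finset B) (w : cs.parNormalizer L) : ℂ :=
  ((LinearMap.det (M := cs.fixSpace (cs.parabolic L))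
    ((cs.reflRep w).toLinearMap.restrict (cs.reflRep_mem_fixSpace w.2)) : ℝ) : ℂ)

/-- `w` is cuspidal in `W_L`: it lies in `W_L` and has no nonzero fixed vector in the orthogonal
complement of `Fix(W_L)`. -/
def IsCuspidal (L : Finset B) (w : cs.parabolic L) : Prop :=
  ∀ v : B →₀ ℝ, (∀ x ∈ cs.fixSpace (cs.parabolic L), reflForm M x v = 0) →
    cs.reflRep (w : W) v = v → v = 0

/-- The set of cuspidal conjugacy classes of `W_L`. -/
def CuspidalClass (L : Finset B) : Type _ :=
  {C : ConjClasses (cs.parabolic L) // ∃ w, ConjClasses.mk w = C ∧ cs.IsCuspidal L w}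

instance [Finite W] (L : Finset B) : Fintype (cs.CuspidalClass L) :=
  have : Finite (cs.CuspidalClass L) := inferInstanceAs (Finite {_C // _})
  Fintype.ofFinite _

/-! ### Descent algebra idempotents and the character of the top component -/

/-- `J ^ x = {x⁻¹ s x : s ∈ J}`, as a set of elements of `W`. -/
def conjSet (J : Finset B) (x : W) : Set W := (fun j => x⁻¹ * cs.simple j * x) '' (J : Set B)

/-- The elements `w` of `P` with `ℓ(s w) > ℓ(w)` for all `s` in `J`.  With `P = W` this is the set
`X_J` of minimal length representatives of the right cosets of `W_J` in `W`; with `P = W_L` and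
`J ⊆ L` it is the same set for the Coxeter group `W_L` (the length function of `W_L` is
the restriction of that of `W`). -/
def minReps (P : Subgroup W) (J : Finset B) : Set W :=
  {w | w ∈ P ∧ ∀ j ∈ J, cs.length w < cs.length (cs.simple j * w)}

/-- The element `x_K = ∑ x⁻¹`, `x` running over `X_K`, formed in the Coxeter group `W_L`. -/
def xElt [Fintype W] (L K : Finset B) : MonoidAlgebra ℂ W :=
  ∑ x : W with x ∈ cs.minReps (cs.parabolic L) K, MonoidAlgebra.of ℂ W x⁻¹

/-- The number `m_{KJ}` formed in the Coxeter group `W_L`, for `J, K ⊆ L`: it is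
`|{x ∈ X_K ∩ X_J : J ^ x ⊆ L}|` if `J ⊆ K` and `0` otherwise. -/
def mCoeff (L K J : Finset B) : ℕ :=
  if J ⊆ K then
    Set.ncard {x | x ∈ cs.minReps (cs.parabolic L) K ∧ x ∈ cs.minReps (cs.parabolic L) J ∧
      cs.conjSet J x ⊆ cs.simple '' (L : Set B)}
  else 0

/-- The elements `e_K` (`K ⊆ L`) formed in the Coxeter group `W_L`: the solution of the triangular
system `x_K = ∑_J m_{KJ} e_J`, see `xElt_eq_sum`. -/
def eElt [Fintype W] (L K : Finset B) : MonoidAlgebra ℂ W :=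
  (cs.mCoeff L K K : ℂ)⁻¹ •
    (cs.xElt L K - ∑ J ∈ K.ssubsets.attach, (cs.mCoeff L K J.1 : ℂ) • eElt L J.1)
termination_by K.card
decreasing_by exact Finset.card_lt_card (Finset.mem_ssubsets.mp J.2)

theorem one_mem_minReps (P : Subgroup W) (J : Finset B) : (1 : W) ∈ cs.minReps P J :=
  ⟨P.one_mem, fun j _ => by simp⟩

theorem mCoeff_self_ne_zero [Finite W] {L K : Finset B} (h : K ⊆ L) : cs.mCoeff L K K ≠ 0 := by
  rw [mCoeff, if_pos (Finset.Subset.refl K)]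
  apply Set.ncard_ne_zero_of_mem (a := 1)
  refine ⟨cs.one_mem_minReps _ _, cs.one_mem_minReps _ _, ?_⟩
  rintro _ ⟨j, hj, rfl⟩
  exact ⟨j, h hj, by simp⟩

/-- The defining system of the `e_K`. -/
theorem xElt_eq_sum [Fintype W] {L K : Finset B} (h : K ⊆ L) :
    cs.xElt L K = ∑ J ∈ K.powerset, (cs.mCoeff L K J : ℂ) • cs.eElt L J := by
  have hm : (cs.mCoeff L K K : ℂ) ≠ 0 := by exact_mod_cast cs.mCoeff_self_ne_zero h
  have h1 : (cs.mCoeff L K K : ℂ) • cs.eElt L K =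
      cs.xElt L K - ∑ J ∈ K.ssubsets, (cs.mCoeff L K J : ℂ) • cs.eElt L J := by
    rw [eElt, smul_smul, mul_inv_cancel₀ hm, one_smul,
      Finset.sum_attach K.ssubsets (fun J => (cs.mCoeff L K J : ℂ) • cs.eElt L J)]
  have h2 : K.powerset = insert K K.ssubsets := by
    ext J
    simp only [Finset.mem_powerset, Finset.mem_insert, Finset.mem_ssubsets]
    exact le_iff_eq_or_lt
  rw [h2, Finset.sum_insert (by simp), h1]
  abel

/-- `N_L = {x ∈ X_L : L ^ x = L}`, the complement of `W_L` in `N_W(W_L)`. -/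
def complementN (L : Finset B) : Set W :=
  {x | x ∈ cs.minReps ⊤ L ∧ cs.conjSet L x = cs.simple '' (L : Set B)}

/-- The right `N_W(W_L)`-module affording the extension of the character of the top component
`E = e_L ℂW_L` of `ℂW_L` (`e_L` formed in `W_L`): the right ideal of `ℂ N_W(W_L)` generated by
`a e_L`, where `a` is the sum of the elements of `N_L`.  As `e_L` commutes with `N_L`, the map
`v ↦ a v` identifies `E` with this right ideal, in such a way that `u ∈ W_L` acts on `E` by right
multiplication `v ↦ v u`, and `n ∈ N_L` acts by conjugation `v ↦ n⁻¹ v n`. -/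
def topModule [Fintype W] (L : Finset B) : Submodule ℂ (MonoidAlgebra ℂ W) :=
  Submodule.span ℂ {v | ∃ w ∈ cs.parNormalizer L,
    v = (∑ n : W with n ∈ cs.complementN L, MonoidAlgebra.of ℂ W n) * cs.eElt L L *
      MonoidAlgebra.of ℂ W w}

theorem mul_mem_topModule [Fintype W] {L : Finset B} {w : W} (hw : w ∈ cs.parNormalizer L)
    (v : MonoidAlgebra ℂ W) (hv : v ∈ cs.topModule L) :
    LinearMap.mulRight ℂ (MonoidAlgebra.of ℂ W w) v ∈ cs.topModule L := by
  induction hv using Submodule.span_induction with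
  | mem x hx =>
    obtain ⟨w', hw', rfl⟩ := hx
    refine Submodule.subset_span ⟨w' * w, mul_mem hw' hw, ?_⟩
    rw [LinearMap.mulRight_apply, map_mul, ← mul_assoc]
  | zero => simp
  | add x y _ _ hx hy => rw [map_add]; exact add_mem hx hy
  | smul c x _ hx => rw [map_smul]; exact Submodule.smul_mem _ _ hx

/-- The character of `N_W(W_L)` on `topModule`, extending the character of the top component of
`ℂW_L`. -/
def PhiTilde [Fintype W] (L : Finset B) (w : cs.parNormalizer L) : ℂ :=
  LinearMap.trace ℂ (cs.topModule L)
    ((LinearMap.mulRight ℂ (MonoidAlgebra.of ℂ W (w : W))).restrict (cs.mul_mem_topModule w.2))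

/-! ### The Orlik-Solomon algebra -/

/-- The set `T` of reflections of `W`. -/
abbrev Refl : Type _ := {t : W // cs.IsReflection t}

/-- `t ^ w = w⁻¹ t w`. -/
def reflConj (w : W) (t : cs.Refl) : cs.Refl :=
  ⟨w⁻¹ * t * w, by simpa using t.2.conj w⁻¹⟩

/-- The intersection of the reflecting hyperplanes (`1`-eigenspaces) of a list of reflections. -/
def interHyp (l : List cs.Refl) : Submodule ℝ (B →₀ ℝ) :=
  ⨅ t ∈ l, Module.End.eigenspace (cs.reflRep (t : W)).toLinearMap 1

/-- The defining relations of the Orlik-Solomon algebra.  A list of `p` hyperplanes is linearly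
dependent if their intersection has codimension smaller than `p`. -/
inductive OSRel : FreeAlgebra ℂ cs.Refl → FreeAlgebra ℂ cs.Refl → Prop
  | anticomm (t t' : cs.Refl) :
      OSRel (FreeAlgebra.ι ℂ t * FreeAlgebra.ι ℂ t') (-(FreeAlgebra.ι ℂ t' * FreeAlgebra.ι ℂ t))
  | dependent (l : List cs.Refl)
      (hl : Module.finrank ℝ (B →₀ ℝ) < Module.finrank ℝ (cs.interHyp l) + l.length) :
      OSRel (∑ i ∈ Finset.range l.length,
        (-1 : ℂ) ^ (i + 1) • ((l.eraseIdx i).map (FreeAlgebra.ι ℂ)).prod) 0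

/-- The Orlik-Solomon algebra `A(W)`. -/
abbrev OrlikSolomon : Type _ := RingQuot cs.OSRel

/-- The generator `a_t`. -/
def osGen (t : cs.Refl) : cs.OrlikSolomon :=
  RingQuot.mkAlgHom ℂ cs.OSRel (FreeAlgebra.ι ℂ t)

theorem interHyp_map (w : W) (l : List cs.Refl) :
    cs.interHyp (l.map (cs.reflConj w)) =
      (cs.interHyp l).map (cs.reflRep w⁻¹).toLinearMap := by
  ext v
  have hv : v ∈ (cs.interHyp l).map (cs.reflRep w⁻¹).toLinearMap ↔
      cs.reflRep w v ∈ cs.interHyp l := by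
    constructor
    · rintro ⟨u, hu, rfl⟩
      have : cs.reflRep w (cs.reflRep w⁻¹ u) = u := by
        rw [← LinearEquiv.mul_apply, ← map_mul]; simp
      change cs.reflRep w (cs.reflRep w⁻¹ u) ∈ _
      rwa [this]
    · intro h
      refine ⟨_, h, ?_⟩
      change cs.reflRep w⁻¹ (cs.reflRep w v) = v
      rw [← LinearEquiv.mul_apply, ← map_mul]; simp
  rw [hv]
  simp only [interHyp, Submodule.mem_iInf, List.mem_map, Module.End.mem_eigenspace_iff, one_smul,
    LinearEquiv.coe_coe]
  constructor
  · intro h t ht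
    have h1 := h _ ⟨t, ht, rfl⟩
    simp only [reflConj, map_mul, LinearEquiv.mul_apply] at h1
    have h2 := congrArg (cs.reflRep w) h1
    rw [← LinearEquiv.mul_apply (cs.reflRep w) (cs.reflRep w⁻¹), ← map_mul] at h2
    simpa using h2
  · rintro h _ ⟨t, ht, rfl⟩
    simp only [reflConj, map_mul, LinearEquiv.mul_apply]
    rw [h t ht, ← LinearEquiv.mul_apply, ← map_mul]
    simp

/-- The right action of `w` on the Orlik-Solomon algebra, `a_t . w = a_{t ^ w}`. -/
def osAct (w : W) : cs.OrlikSolomon →ₐ[ℂ] cs.OrlikSolomon :=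
  RingQuot.liftAlgHom ℂ ⟨FreeAlgebra.lift ℂ fun t => cs.osGen (cs.reflConj w t), by
    intro x y hxy
    induction hxy with
    | anticomm t t' =>
      simp only [map_mul, map_neg, FreeAlgebra.lift_ι_apply, osGen]
      simpa using RingQuot.mkAlgHom_rel ℂ (OSRel.anticomm (cs.reflConj w t) (cs.reflConj w t'))
    | dependent l hl =>
      have h := RingQuot.mkAlgHom_rel ℂ (OSRel.dependent (cs := cs) (l.map (cs.reflConj w)) (by
        rw [cs.interHyp_map, List.length_map, LinearEquiv.finrank_map_eq]
        exact hl))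
      rw [map_zero] at h ⊢
      rw [← h]
      simp only [map_sum, map_smul, map_list_prod, List.map_map, List.length_map,
        List.eraseIdx_map]
      refine Finset.sum_congr rfl fun i _ => ?_
      congr 3
      funext t
      simp [osGen]⟩

theorem osAct_osGen (w : W) (t : cs.Refl) : cs.osAct w (cs.osGen t) = cs.osGen (cs.reflConj w t) := by
  simp [osAct, osGen]

/-- The subspace `A_X` of `A(W)` spanned by the products `a_{t_1} ⋯ a_{t_p}` with
`H_{t_1} ∩ ⋯ ∩ H_{t_p} = X`, where `p` is the codimension of `X`. -/
def osComponent (X : Submodule ℝ (B →₀ ℝ)) : Submodule ℂ cs.OrlikSolomon :=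
  Submodule.span ℂ {a | ∃ l : List cs.Refl,
    l.length + Module.finrank ℝ X = Module.finrank ℝ (B →₀ ℝ) ∧
    cs.interHyp l = X ∧ a = (l.map cs.osGen).prod}

theorem osAct_mem_osComponent {L : Finset B} {w : W} (hw : w ∈ cs.parNormalizer L)
    (a : cs.OrlikSolomon) (ha : a ∈ cs.osComponent (cs.fixSpace (cs.parabolic L))) :
    (cs.osAct w).toLinearMap a ∈ cs.osComponent (cs.fixSpace (cs.parabolic L)) := by
  induction ha using Submodule.span_induction with
  | mem x hx =>
    obtain ⟨l, hl, hX, rfl⟩ := hx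
    refine Submodule.subset_span ⟨l.map (cs.reflConj w), by simpa using hl, ?_, ?_⟩
    · rw [cs.interHyp_map, hX]
      apply le_antisymm
      · rintro _ ⟨v, hv, rfl⟩
        exact cs.reflRep_mem_fixSpace (inv_mem hw) v hv
      · intro v hv
        refine ⟨cs.reflRep w v, cs.reflRep_mem_fixSpace hw v hv, ?_⟩
        change cs.reflRep w⁻¹ (cs.reflRep w v) = v
        rw [← LinearEquiv.mul_apply, ← map_mul]; simp
    · rw [AlgHom.toLinearMap_apply, map_list_prod, List.map_map, List.map_map]
      congr 2
      funext t
      exact cs.osAct_osGen w t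
  | zero => simp
  | add x y _ _ hx hy => rw [map_add]; exact add_mem hx hy
  | smul c x _ hx => rw [map_smul]; exact Submodule.smul_mem _ _ hx

/-- The character of `N_W(W_L)` on `A_X`, where `X = Fix(W_L)`.  As `A_X` is the image of
the top component of `A(W_L)`, it extends the character of that top component. -/
def PsiTilde (L : Finset B) (w : cs.parNormalizer L) : ℂ :=
  LinearMap.trace ℂ (cs.osComponent (cs.fixSpace (cs.parabolic L)))
    ((cs.osAct (w : W)).toLinearMap.restrict (cs.osAct_mem_osComponent w.2))

end CoxeterSystem

/-- The function on `K` induced from a function `φ` on `H`, for subgroups `H ≤ K` of a finite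
group: `g ↦ |H|⁻¹ ∑ φ(x g x⁻¹)`, the sum over those `x` in `K` for which `x g x⁻¹ ∈ H`. -/
def inducedFun {G : Type*} [Group G] [Fintype G] (H K : Subgroup G) (_hHK : H ≤ K)
    (φ : H → ℂ) (g : K) : ℂ :=
  (Nat.card H : ℂ)⁻¹ *
    ∑ x : K, if h : (x * g * x⁻¹ : G) ∈ H then φ ⟨x * g * x⁻¹, h⟩ else 0

end

/-!
If `L` has at most one element, then `W_L` has exactly one cuspidal class, and `N_W(W_L)` is the
centralizer of its representative (`1` if `L = ∅`, and `s` if `L = {s}`).  Hence nothing is really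
induced, and the theorem says that the characters `Φ` and `Ψ` of `N_W(W_L)` are linear, with
`Ψ = Φ ε α_L`; see `exists_characters_of_unique_class`.

That the classes are as described uses that the form on `V` is nondegenerate for finite `W`
(`eq_zero_of_reflForm_eq_zero`), so that the orthogonal complement of `Fix(W_L)` is `0`, or the
line of the root `α_s`.

Both modules are lines.  The space `A_X` is spanned by `1` or `a_s`, which `N_W(W_L)` fixes, so
`Ψ = 1`; that these elements are not zero is seen in the dual numbers (`osToDualNumber`).  The top
component is spanned by `(∑_{n ∈ N_L} n) e_L`.  For `L = ∅` this is the sum of all elements of `W`,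
so `Φ = 1`, and `α_L = det = ε`.  For `L = {s}` one has `e_L = (1 - s) / 2`.  An element `c` of the
centralizer of `s` maps `α_s` to `λ(c) α_s` with `λ(c) = ± 1`, and `ε = det = λ α_L` there.  The
crucial point is that `N_L` is the kernel of `λ`, which gives `Φ = λ`, and `λ ε α_L = 1`
follows.  As `N_L` is defined by lengths, this needs the fact that `w α_s ≥ 0` whenever
`ℓ (w s) > ℓ w` (`reflRep_single_nonneg`).
-/

namespace CoxeterSystem

/-! ### Roots and descents -/

variable {B W : Type*} [Group W] {M : CoxeterMatrix B} (cs : CoxeterSystem M W)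

theorem reflRep_simple (i : B) : cs.reflRep (cs.simple i) = simpleRefl M i :=
  cs.lift_apply_simple (isLiftable_simpleRefl M) i

theorem reflRep_simple_apply (i : B) (v : B →₀ ℝ) :
    cs.reflRep (cs.simple i) v =
      v - (2 * reflForm M (Finsupp.single i 1) v) • Finsupp.single i 1 := by
  rw [reflRep_simple, simpleRefl, Module.reflection_apply]
  simp

theorem reflRep_mul_apply (u w : W) (v : B →₀ ℝ) :
    cs.reflRep (u * w) v = cs.reflRep u (cs.reflRep w v) := by
  rw [map_mul, LinearEquiv.mul_apply]

theorem reflForm_self (i : B) : reflForm M (Finsupp.single i 1) (Finsupp.single i 1) = 1 := by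
  simp [reflForm_single]

theorem reflRep_simple_single (i : B) :
    cs.reflRep (cs.simple i) (Finsupp.single i 1) = -Finsupp.single i 1 := by
  rw [reflRep_simple_apply, reflForm_self]
  module

/-- The coefficients of the roots in a rank two subsystem with angle `θ = π / m`: the `k`-th one
is `sin (k θ) / sin θ`, and it is `k` if `m = 0` (which stands for `∞`).  It is written as a value
of a Chebyshev polynomial to include the latter case. -/
noncomputable def dihedralCoeff (m k : ℕ) : ℝ :=
  (Polynomial.Chebyshev.S ℝ ((k : ℤ) - 1)).eval (2 * Real.cos (Real.pi / (m : ℝ)))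

theorem dihedralCoeff_zero (m : ℕ) : dihedralCoeff m 0 = 0 := by
  simp [dihedralCoeff]

theorem dihedralCoeff_one (m : ℕ) : dihedralCoeff m 1 = 1 := by
  simp [dihedralCoeff]

theorem dihedralCoeff_add_two (m k : ℕ) :
    dihedralCoeff m (k + 2) =
      2 * Real.cos (Real.pi / (m : ℝ)) * dihedralCoeff m (k + 1) - dihedralCoeff m k := by
  unfold dihedralCoeff
  have e1 : ((k + 2 : ℕ) : ℤ) - 1 = ((k : ℤ) - 1) + 2 := by push_cast; ring
  have e2 : ((k + 1 : ℕ) : ℤ) - 1 = ((k : ℤ) - 1) + 1 := by push_cast; ring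
  rw [e1, e2, Polynomial.Chebyshev.S_add_two]
  simp

theorem dihedralCoeff_nonneg {m k : ℕ} (hm : m ≠ 1) (hk : m ≠ 0 → k ≤ m) :
    0 ≤ dihedralCoeff m k := by
  rcases Nat.eq_zero_or_pos m with rfl | h0
  · simp [dihedralCoeff]
  have hm2 : (2 : ℝ) ≤ m := by exact_mod_cast (show 2 ≤ m by omega)
  have hkm : (k : ℝ) ≤ m := by exact_mod_cast hk (by omega)
  have hpi := Real.pi_pos
  have hθm : m * (Real.pi / m) = Real.pi := by field_simp
  have hθ : 0 < Real.pi / (m : ℝ) := by positivity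
  have hs : 0 < Real.sin (Real.pi / m) :=
    Real.sin_pos_of_pos_of_lt_pi hθ (by nlinarith)
  have h := Polynomial.Chebyshev.S_two_mul_real_cos (Real.pi / m) ((k : ℤ) - 1)
  have hsk : 0 ≤ Real.sin ((((k : ℤ) - 1 : ℤ) + 1) * (Real.pi / m)) := by
    push_cast
    rw [sub_add_cancel]
    exact Real.sin_nonneg_of_nonneg_of_le_pi (by positivity)
      ((mul_le_mul_of_nonneg_right hkm hθ.le).trans_eq hθm)
  rw [← h] at hsk
  exact nonneg_of_mul_nonneg_left hsk hs

theorem reflRep_alternatingWord (i j : B) (k : ℕ) :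
    cs.reflRep (cs.wordProd (alternatingWord i j k)) (Finsupp.single i 1) =
      dihedralCoeff (M i j) (k + 1) • Finsupp.single (if Even k then i else j) 1 +
        dihedralCoeff (M i j) k • Finsupp.single (if Even k then j else i) 1 := by
  have key : ∀ x y : B, reflForm M (Finsupp.single x 1) (Finsupp.single y 1) =
      -Real.cos (Real.pi / (M i j : ℝ)) → ∀ n : ℕ,
      cs.reflRep (cs.simple x) (dihedralCoeff (M i j) (n + 1) • Finsupp.single y 1 +
        dihedralCoeff (M i j) n • Finsupp.single x 1) =
      dihedralCoeff (M i j) (n + 2) • Finsupp.single x 1 +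
        dihedralCoeff (M i j) (n + 1) • Finsupp.single y 1 := by
    intro x y hxy n
    rw [map_add, map_smul, map_smul, reflRep_simple_single, reflRep_simple_apply, hxy,
      dihedralCoeff_add_two]
    module
  induction k with
  | zero => simp [dihedralCoeff_zero, dihedralCoeff_one, alternatingWord]
  | succ k ih =>
    rw [alternatingWord_succ', wordProd_cons, reflRep_mul_apply, ih]
    by_cases hk : Even k
    · have hk' : ¬ Even (k + 1) := by simp [hk, parity_simps]
      simp only [hk, hk', if_true, if_false]
      exact key j i (by rw [reflForm_single, M.symmetric]) k
    · have hk' : Even (k + 1) := by simp [hk, parity_simps]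
      simp only [hk, hk', if_true, if_false]
      exact key i j (reflForm_single M i j) k

/-- If `ℓ (w s_i) > ℓ w`, then `w` sends the simple root `α_i` to a nonnegative combination of
simple roots.  A right descent `j` of `w` is chosen, and `w` is written as `v` times an element of
the dihedral group of `i` and `j`, as long as possible with additive lengths.  Induction applies
to `v`, and the dihedral factor is computed explicitly. -/
theorem reflRep_single_nonneg (w : W) (i : B) (h : cs.length w < cs.length (w * cs.simple i)) :
    0 ≤ cs.reflRep w (Finsupp.single i 1) := by
  induction hn : cs.length w using Nat.strong_induction_on generalizing w i with
  | _ n IH =>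
  subst hn
  by_cases hw : w = 1
  · subst hw
    simp
  obtain ⟨j, hj⟩ := cs.exists_rightDescent_of_ne_one hw
  have hij : i ≠ j := by rintro rfl; exact absurd hj (not_lt.mpr h.le)
  classical
  let p : ℕ → Prop := fun k => ∃ v, w = v * cs.wordProd (alternatingWord i j k) ∧
    cs.length w = cs.length v + k
  have hp1 : p 1 := by
    refine ⟨w * cs.simple j, ?_, (cs.isRightDescent_iff.mp hj).symm⟩
    simp [alternatingWord]
  have hbound : ∀ k, p k → k ≤ cs.length w := by
    rintro k ⟨v, -, hv⟩
    omega
  obtain ⟨v, hwv, hlv⟩ : p (Nat.findGreatest p (cs.length w)) :=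
    Nat.findGreatest_spec (hbound 1 hp1) hp1
  have hk1 : 1 ≤ Nat.findGreatest p (cs.length w) := Nat.le_findGreatest (hbound 1 hp1) hp1
  have hmax : ¬ p (Nat.findGreatest p (cs.length w) + 1) := fun hp =>
    absurd (Nat.le_findGreatest (hbound _ hp) hp) (by omega)
  generalize Nat.findGreatest p (cs.length w) = k at hwv hlv hk1 hmax
  obtain ⟨k, rfl⟩ : ∃ l, k = l + 1 := ⟨k - 1, by omega⟩
  -- the letter that would prolong the dihedral factor is an ascent of `v`, by maximality
  have hasc1 : cs.length v < cs.length (v * cs.simple (if Even (k + 1) then j else i)) := by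
    by_contra hcon
    refine hmax ⟨v * cs.simple (if Even (k + 1) then j else i), ?_, ?_⟩
    · rw [alternatingWord_succ', wordProd_cons, hwv, mul_assoc, simple_mul_simple_cancel_left]
    · have := (cs.length_mul_simple v (if Even (k + 1) then j else i))
      omega
  -- the first letter of the dihedral factor is an ascent of `v`, as lengths are additive
  have hasc2 : cs.length v < cs.length (v * cs.simple (if Even k then j else i)) := by
    have h1 : w = v * cs.simple (if Even k then j else i) *
        cs.wordProd (alternatingWord i j k) := by
      rw [hwv, alternatingWord_succ', wordProd_cons, mul_assoc]
    have h2 := cs.length_mul_le (v * cs.simple (if Even k then j else i))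
      (cs.wordProd (alternatingWord i j k))
    rw [← h1] at h2
    have h3 := cs.length_wordProd_le (alternatingWord i j k)
    rw [length_alternatingWord] at h3
    omega
  -- the dihedral factor is not the longest element, otherwise `i` would be a descent of `w`
  have hkm : M i j ≠ 0 → k + 2 ≤ M i j := by
    intro hm
    by_contra hcon
    have hsplit : ∀ a b : ℕ, ∃ u, cs.wordProd (alternatingWord i j (a + b)) =
        u * cs.wordProd (alternatingWord i j b) ∧ cs.length u ≤ a := by
      intro a b
      induction a with
      | zero => exact ⟨1, by simp, by simp⟩
      | succ a ih =>
        obtain ⟨u, hu, hul⟩ := ih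
        refine ⟨cs.simple (if Even (a + b) then j else i) * u, ?_, ?_⟩
        · rw [Nat.add_right_comm, alternatingWord_succ', wordProd_cons, hu, mul_assoc]
        · have := cs.length_mul_le (cs.simple (if Even (a + b) then j else i)) u
          rw [length_simple] at this
          omega
    obtain ⟨u, hu, hul⟩ := hsplit (k + 1 - M i j) (M i j)
    rw [Nat.sub_add_cancel (by omega)] at hu
    obtain ⟨m, hm'⟩ : ∃ m, M i j = m + 1 := ⟨M i j - 1, by omega⟩
    have hbraid := cs.wordProd_braidWord_eq i j
    rw [braidWord, braidWord, M.symmetric j i] at hbraid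
    rw [hbraid, hm', alternatingWord_succ j i m, List.concat_eq_append, wordProd_append,
      wordProd_singleton] at hu
    have hw2 : w * cs.simple i = v * u * cs.wordProd (alternatingWord i j m) := by
      rw [hwv, hu]
      simp [mul_assoc]
    have h1 := cs.length_mul_le (v * u) (cs.wordProd (alternatingWord i j m))
    have h2 := cs.length_mul_le v u
    have h3 := cs.length_wordProd_le (alternatingWord i j m)
    rw [length_alternatingWord] at h3
    rw [← hw2] at h1
    omega
  have hM1 : M i j ≠ 1 := M.off_diagonal i j hij
  have hc1 := dihedralCoeff_nonneg (m := M i j) (k := k + 1) hM1 fun h0 => by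
    have := hkm h0; omega
  have hc2 := dihedralCoeff_nonneg (m := M i j) (k := k + 2) hM1 hkm
  have hv1 := IH (cs.length v) (by omega) v _ hasc1 rfl
  have hv2 := IH (cs.length v) (by omega) v _ hasc2 rfl
  have hpar : (if Even (k + 1) then i else j) = if Even k then j else i := by
    by_cases hk : Even k <;> simp [hk, parity_simps]
  rw [hwv, reflRep_mul_apply, reflRep_alternatingWord, map_add, map_smul, map_smul, hpar]
  exact add_nonneg (smul_nonneg hc2 hv2) (smul_nonneg hc1 hv1)

end CoxeterSystem

/-! ### Linear algebra on lines and hyperplanes -/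

section LinearAlgebra

theorem LinearMap.det_eq_det_restrict_mul_of_quotient {K V : Type*} [Field K] [AddCommGroup V]
    [Module K V] [FiniteDimensional K V] (p : Submodule K V) (f : V →ₗ[K] V)
    (hp : ∀ v ∈ p, f v ∈ p) (h1 : Module.finrank K (V ⧸ p) = 1) (c : K)
    (hc : ∀ v, f v - c • v ∈ p) :
    LinearMap.det f = LinearMap.det (f.restrict hp) * c := by
  rw [LinearMap.det_eq_det_mul_det p f hp]
  have h : p.mapQ p f hp = c • LinearMap.id := by
    ext v
    simpa using (Submodule.Quotient.eq p).mpr (hc v)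
  rw [h, LinearMap.det_smul, h1]
  simp

theorem LinearMap.trace_restrict_span_singleton {K V : Type*} [Field K] [AddCommGroup V]
    [Module K V] {v : V} (hv : v ≠ 0) {p : Submodule K V} (hpv : p = K ∙ v) (f : V →ₗ[K] V)
    (hp : ∀ x ∈ p, f x ∈ p) {c : K} (hc : f v = c • v) :
    LinearMap.trace K p (f.restrict hp) = c := by
  subst hpv
  have h : f.restrict hp = c • LinearMap.id := by
    ext ⟨x, hx⟩
    obtain ⟨a, rfl⟩ := Submodule.mem_span_singleton.mp hx
    simp [hc, smul_comm a c]
  rw [h, map_smul, LinearMap.trace_id, finrank_span_singleton hv]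
  simp

end LinearAlgebra

namespace CoxeterSystem

variable {B W : Type*} [Group W] {M : CoxeterMatrix B} (cs : CoxeterSystem M W)

/-! ### The invariant form -/

theorem reflForm_comm (u v : B →₀ ℝ) : reflForm M u v = reflForm M v u := by
  have h : reflForm M = (reflForm M).flip := by
    ext i j
    simp [reflForm_single, M.symmetric i j]
  exact LinearMap.congr_fun₂ h u v

theorem reflForm_reflRep (w : W) (u v : B →₀ ℝ) :
    reflForm M (cs.reflRep w u) (cs.reflRep w v) = reflForm M u v := by
  induction w using cs.simple_induction_left generalizing u v with
  | one => simp
  | mul_simple_left w i ih =>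
    rw [reflRep_mul_apply, reflRep_mul_apply, reflRep_simple_apply, reflRep_simple_apply]
    simp only [map_sub, map_smul, LinearMap.sub_apply, LinearMap.smul_apply, smul_eq_mul,
      reflForm_self, ih, reflForm_comm (cs.reflRep w u) (Finsupp.single i 1)]
    ring

/-- The form is nondegenerate if `W` is finite.  A vector of the radical is fixed by `W`; but the
sum of all elements of `W` is zero on `V`, as it is invariant under `s_i`, which negates `α_i`. -/
theorem eq_zero_of_reflForm_eq_zero (cs : CoxeterSystem M W) [Finite W] {v : B →₀ ℝ}
    (hv : ∀ x, reflForm M x v = 0) : v = 0 := by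
  have := Fintype.ofFinite W
  have hfix : ∀ w, cs.reflRep w v = v := fun w => by
    induction w using cs.simple_induction_left with
    | one => simp
    | mul_simple_left w i ih => rw [reflRep_mul_apply, ih, reflRep_simple_apply, hv]; simp
  let P : (B →₀ ℝ) →ₗ[ℝ] (B →₀ ℝ) := ∑ w : W, (cs.reflRep w).toLinearMap
  have hP : P = 0 := by
    ext1 i
    ext1
    change P (Finsupp.single i 1) = 0
    have h : P (cs.reflRep (cs.simple i) (Finsupp.single i 1)) = P (Finsupp.single i 1) := by
      simp only [P, LinearMap.sum_apply, LinearEquiv.coe_coe, ← reflRep_mul_apply]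
      exact Fintype.sum_equiv (Equiv.mulRight (cs.simple i)) _ _ fun w => rfl
    rw [reflRep_simple_single, map_neg] at h
    exact self_eq_neg.mp h.symm
  have h2 : (Fintype.card W : ℝ) • v = 0 := by
    have : P v = (Fintype.card W : ℝ) • v := by
      simp [P, LinearMap.sum_apply, hfix, Nat.cast_smul_eq_nsmul]
    rw [← this, hP, LinearMap.zero_apply]
  exact (smul_eq_zero.mp h2).resolve_left (by simp)

/-- The hyperplane orthogonal to the simple root `α_i`. -/
noncomputable def simpleHyp (M : CoxeterMatrix B) (i : B) : Submodule ℝ (B →₀ ℝ) :=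
  LinearMap.ker (reflForm M (Finsupp.single i 1))

theorem mem_simpleHyp {i : B} {v : B →₀ ℝ} :
    v ∈ simpleHyp M i ↔ reflForm M (Finsupp.single i 1) v = 0 := Iff.rfl

theorem reflForm_single_surjective (i : B) :
    Function.Surjective (reflForm M (Finsupp.single i 1)) := fun a =>
  ⟨a • Finsupp.single i 1, by rw [map_smul, reflForm_self, smul_eq_mul, mul_one]⟩

theorem finrank_quotient_simpleHyp (i : B) :
    Module.finrank ℝ ((B →₀ ℝ) ⧸ simpleHyp M i) = 1 := by
  rw [simpleHyp, ((reflForm M (Finsupp.single i 1)).quotKerEquivOfSurjective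
    (reflForm_single_surjective i)).finrank_eq, Module.finrank_self]

theorem sub_smul_single_mem_simpleHyp (i : B) (v : B →₀ ℝ) :
    v - reflForm M (Finsupp.single i 1) v • Finsupp.single i 1 ∈ simpleHyp M i := by
  rw [mem_simpleHyp, map_sub, map_smul, reflForm_self, smul_eq_mul, mul_one, sub_self]

theorem reflRep_simple_eq_self_iff {i : B} {v : B →₀ ℝ} :
    cs.reflRep (cs.simple i) v = v ↔ v ∈ simpleHyp M i := by
  rw [reflRep_simple_apply, sub_eq_self, mem_simpleHyp, smul_eq_zero_iff_left (by simp)]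
  simp

/-! ### The centralizer of a simple reflection -/

/-- The scalar `⟨α_i, w α_i⟩`.  If `w` commutes with `s_i`, it is the sign by which `w` acts on the
root `α_i`, see `reflRep_single_of_commute`; otherwise it has no such meaning. -/
noncomputable def rootSign (i : B) (w : W) : ℝ :=
  reflForm M (Finsupp.single i 1) (cs.reflRep w (Finsupp.single i 1))

theorem reflRep_single_of_commute {i : B} {w : W} (hw : Commute w (cs.simple i)) :
    cs.reflRep w (Finsupp.single i 1) = cs.rootSign i w • Finsupp.single i 1 := by
  have h : cs.reflRep (cs.simple i) (cs.reflRep w (Finsupp.single i 1)) =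
      -cs.reflRep w (Finsupp.single i 1) := by
    rw [← reflRep_mul_apply, ← hw.eq, reflRep_mul_apply, reflRep_simple_single, map_neg]
  rw [reflRep_simple_apply] at h
  rw [rootSign]
  linear_combination (norm := module) (1 / 2 : ℝ) • h

theorem rootSign_one (i : B) : cs.rootSign i 1 = 1 := by
  simp [rootSign, reflForm_self]

theorem rootSign_simple (i : B) : cs.rootSign i (cs.simple i) = -1 := by
  rw [rootSign, reflRep_simple_single, map_neg, reflForm_self]

theorem rootSign_mul {i : B} (u : W) {w : W} (hw : Commute w (cs.simple i)) :
    cs.rootSign i (u * w) = cs.rootSign i u * cs.rootSign i w := by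
  rw [rootSign, reflRep_mul_apply, reflRep_single_of_commute cs hw, map_smul, map_smul,
    smul_eq_mul, mul_comm, rootSign, rootSign]

theorem rootSign_mul_self {i : B} {w : W} (hw : Commute w (cs.simple i)) :
    cs.rootSign i w * cs.rootSign i w = 1 := by
  have h := cs.reflForm_reflRep w (Finsupp.single i 1) (Finsupp.single i 1)
  rwa [reflRep_single_of_commute cs hw, map_smul, map_smul, LinearMap.smul_apply, reflForm_self,
    smul_eq_mul, smul_eq_mul, mul_one] at h

theorem rootSign_eq_one_of_length_lt {i : B} {w : W} (hw : Commute w (cs.simple i))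
    (h : cs.length w < cs.length (cs.simple i * w)) : cs.rootSign i w = 1 := by
  rw [← hw.eq] at h
  have hpos := cs.reflRep_single_nonneg w i h i
  rw [reflRep_single_of_commute cs hw] at hpos
  have hpos' : 0 ≤ cs.rootSign i w := by simpa using hpos
  nlinarith [cs.rootSign_mul_self hw]

theorem length_lt_of_rootSign_eq_one {i : B} {w : W} (hw : Commute w (cs.simple i))
    (h : cs.rootSign i w = 1) : cs.length w < cs.length (cs.simple i * w) := by
  by_contra hcon
  have hne := cs.length_simple_mul_ne w i
  have hs : Commute (cs.simple i) (cs.simple i) := Commute.refl _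
  have h1 := cs.rootSign_eq_one_of_length_lt (hs.mul_left hw) (by
    rw [simple_mul_simple_cancel_left]
    omega)
  rw [rootSign_mul cs _ hw, rootSign_simple, h] at h1
  norm_num at h1

theorem mem_centralizer_simple_iff {i : B} {w : W} :
    w ∈ Subgroup.centralizer {cs.simple i} ↔ Commute w (cs.simple i) :=
  Subgroup.mem_centralizer_singleton_iff.trans ⟨fun h => h, fun h => h⟩

/-- The linear character of the centralizer of `s_i` on the line spanned by `α_i`. -/
noncomputable def rootSignHom (i : B) : Subgroup.centralizer {cs.simple i} →* ℂˣ :=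
  MonoidHom.toHomUnits
    { toFun := fun w => (cs.rootSign i w : ℂ)
      map_one' := by simp [rootSign_one]
      map_mul' := fun u w => by
        rw [Subgroup.coe_mul, rootSign_mul cs _ (cs.mem_centralizer_simple_iff.mp w.2)]
        push_cast
        rfl }

/-! ### Determinants -/

theorem det_eq_det_restrict_mul_rootSign [Finite B] {i : B} {w : W}
    (hw : Commute w (cs.simple i))
    (hp : ∀ v ∈ simpleHyp M i, (cs.reflRep w).toLinearMap v ∈ simpleHyp M i) :
    LinearMap.det (cs.reflRep w).toLinearMap =
      LinearMap.det (M := simpleHyp M i) ((cs.reflRep w).toLinearMap.restrict hp) *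
        cs.rootSign i w := by
  refine LinearMap.det_eq_det_restrict_mul_of_quotient _ _ hp (finrank_quotient_simpleHyp i) _ ?_
  intro v
  have h := hp _ (sub_smul_single_mem_simpleHyp i v)
  have h2 := (simpleHyp M i).smul_mem (cs.rootSign i w) (sub_smul_single_mem_simpleHyp i v)
  have h3 := sub_mem h h2
  rw [LinearEquiv.coe_coe, map_sub, map_smul, reflRep_single_of_commute cs hw] at h3
  convert h3 using 1
  rw [LinearEquiv.coe_coe]
  module

theorem det_reflRep [Finite B] (w : W) :
    LinearMap.det (cs.reflRep w).toLinearMap = (-1) ^ cs.length w := by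
  have hsimple : ∀ i, LinearMap.det (cs.reflRep (cs.simple i)).toLinearMap = -1 := by
    intro i
    have hfix : ∀ v ∈ simpleHyp M i, (cs.reflRep (cs.simple i)).toLinearMap v = v :=
      fun v hv => cs.reflRep_simple_eq_self_iff.mpr hv
    have hp : ∀ v ∈ simpleHyp M i, (cs.reflRep (cs.simple i)).toLinearMap v ∈ simpleHyp M i :=
      fun v hv => (hfix v hv).symm ▸ hv
    rw [cs.det_eq_det_restrict_mul_rootSign (Commute.refl _) hp, rootSign_simple]
    have h : (cs.reflRep (cs.simple i)).toLinearMap.restrict hp = LinearMap.id := by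
      ext1 v
      exact Subtype.ext (hfix v v.2)
    rw [h, LinearMap.det_id, one_mul]
  induction w using cs.simple_induction_left with
  | one => simp
  | mul_simple_left w i ih =>
    rw [map_mul]
    change LinearMap.det ((cs.reflRep (cs.simple i)).toLinearMap ∘ₗ (cs.reflRep w).toLinearMap) = _
    rw [LinearMap.det_comp, hsimple, ih]
    rcases cs.length_simple_mul w i with h | h
    · rw [h]; ring
    · rw [← h]; ring

theorem signChar_eq_det [Finite B] (w : W) :
    cs.signChar w = (LinearMap.det (cs.reflRep w).toLinearMap : ℝ) := by
  rw [det_reflRep, signChar]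
  push_cast
  rfl

theorem signChar_mul_self (w : W) : cs.signChar w * cs.signChar w = 1 := by
  rw [signChar, ← mul_pow]
  simp

/-! ### Parabolic subgroups of rank at most one -/

theorem parabolic_empty : cs.parabolic ∅ = ⊥ := by
  simp [parabolic]

theorem parabolic_singleton (i : B) : cs.parabolic {i} = Subgroup.closure {cs.simple i} := by
  simp [parabolic]

theorem mem_parabolic_singleton {i : B} {w : W} :
    w ∈ cs.parabolic {i} ↔ w = 1 ∨ w = cs.simple i := by
  rw [parabolic_singleton]
  constructor
  · intro h
    induction h using Subgroup.closure_induction with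
    | mem x hx => exact Or.inr hx
    | one => exact Or.inl rfl
    | mul x y _ _ hx hy => rcases hx with rfl | rfl <;> rcases hy with rfl | rfl <;> simp
    | inv x _ hx => rcases hx with rfl | rfl <;> simp
  · rintro (rfl | rfl)
    · exact one_mem _
    · exact Subgroup.subset_closure rfl

theorem simple_ne_one (i : B) : cs.simple i ≠ 1 := fun h => by
  have := cs.length_simple i
  rw [h, length_one] at this
  omega

theorem parNormalizer_empty : cs.parNormalizer ∅ = ⊤ := by
  rw [parNormalizer, parabolic_empty]
  exact Subgroup.normalizer_eq_top_iff.mpr inferInstance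

theorem mem_parNormalizer_singleton {i : B} {w : W} :
    w ∈ cs.parNormalizer {i} ↔ Commute w (cs.simple i) := by
  rw [parNormalizer, Subgroup.mem_normalizer_iff]
  constructor
  · intro h
    have h1 := (h (cs.simple i)).mp (cs.mem_parabolic_singleton.mpr (Or.inr rfl))
    rcases cs.mem_parabolic_singleton.mp h1 with h2 | h2
    · exact absurd (conj_eq_one_iff.mp h2) (cs.simple_ne_one i)
    · exact mul_inv_eq_iff_eq_mul.mp h2
  · intro h u
    have hc : w * cs.simple i * w⁻¹ = cs.simple i := mul_inv_eq_iff_eq_mul.mpr h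
    rw [mem_parabolic_singleton, mem_parabolic_singleton, conj_eq_one_iff]
    nth_rw 2 [← hc]
    rw [mul_left_inj, mul_right_inj]

theorem centralizer_simple (i : B) :
    Subgroup.centralizer {cs.simple i} = cs.parNormalizer {i} := by
  ext w
  rw [mem_centralizer_simple_iff, mem_parNormalizer_singleton]

theorem fixSpace_empty : cs.fixSpace (cs.parabolic ∅) = ⊤ := by
  rw [parabolic_empty, eq_top_iff]
  rintro v - w hw
  rw [Subgroup.mem_bot.mp hw, map_one]
  rfl

theorem fixSpace_singleton (i : B) : cs.fixSpace (cs.parabolic {i}) = simpleHyp M i := by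
  ext v
  rw [← cs.reflRep_simple_eq_self_iff]
  refine ⟨fun h => h _ (cs.mem_parabolic_singleton.mpr (Or.inr rfl)), fun h w hw => ?_⟩
  rcases cs.mem_parabolic_singleton.mp hw with rfl | rfl
  · rw [map_one]; rfl
  · exact h

theorem isCuspidal_empty [Finite W] (w : cs.parabolic ∅) : cs.IsCuspidal ∅ w := fun _ hv _ =>
  eq_zero_of_reflForm_eq_zero cs fun x => hv x (cs.fixSpace_empty ▸ Submodule.mem_top)

theorem isCuspidal_singleton_iff [Finite W] {i : B} (w : cs.parabolic {i}) :
    cs.IsCuspidal {i} w ↔ (w : W) = cs.simple i := by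
  rw [IsCuspidal, fixSpace_singleton]
  constructor
  · intro h
    refine (cs.mem_parabolic_singleton.mp w.2).resolve_left fun h1 => ?_
    have h2 := h (Finsupp.single i 1) (fun x hx => by rw [reflForm_comm]; exact hx)
      (by rw [h1, map_one]; rfl)
    simp at h2
  · intro h v hv hfix
    rw [h, reflRep_simple_eq_self_iff, mem_simpleHyp] at hfix
    refine eq_zero_of_reflForm_eq_zero cs fun x => ?_
    have hx := hv _ (sub_smul_single_mem_simpleHyp i x)
    rwa [map_sub, map_smul, LinearMap.sub_apply, LinearMap.smul_apply, hfix, smul_zero,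
      sub_zero] at hx

theorem alphaChar_empty [Finite B] (w : cs.parNormalizer ∅) :
    cs.alphaChar ∅ w = cs.signChar (w : W) := by
  have key : ∀ (p : Submodule ℝ (B →₀ ℝ)) (_ : p = ⊤)
      (hp : ∀ v ∈ p, (cs.reflRep (w : W)).toLinearMap v ∈ p),
      LinearMap.det (M := p) ((cs.reflRep (w : W)).toLinearMap.restrict hp) =
        LinearMap.det (cs.reflRep (w : W)).toLinearMap := by
    rintro p rfl hp
    exact LinearMap.det_conj ((cs.reflRep (w : W)).toLinearMap.restrict hp)
      Submodule.topEquiv |>.symm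
  rw [signChar_eq_det, alphaChar, key _ cs.fixSpace_empty (cs.reflRep_mem_fixSpace w.2)]

/-- On the centralizer of `s_i`, the sign is the product of the determinant on the reflecting
hyperplane and the sign on the root line. -/
theorem alphaChar_singleton_mul_rootSign [Finite B] {i : B} (w : cs.parNormalizer {i}) :
    cs.alphaChar {i} w * cs.rootSign i (w : W) = cs.signChar (w : W) := by
  have hw := cs.mem_parNormalizer_singleton.mp w.2
  have key : ∀ (p : Submodule ℝ (B →₀ ℝ)) (_ : p = simpleHyp M i)
      (hp : ∀ v ∈ p, (cs.reflRep (w : W)).toLinearMap v ∈ p),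
      LinearMap.det (M := p) ((cs.reflRep (w : W)).toLinearMap.restrict hp) *
        cs.rootSign i (w : W) = LinearMap.det (cs.reflRep (w : W)).toLinearMap := by
    rintro p rfl hp
    exact (cs.det_eq_det_restrict_mul_rootSign hw hp).symm
  rw [signChar_eq_det, alphaChar, ← Complex.ofReal_mul,
    key _ (cs.fixSpace_singleton i) (cs.reflRep_mem_fixSpace w.2)]

/-! ### The top component of the group algebra -/

theorem minReps_empty (P : Subgroup W) : cs.minReps P ∅ = P := by
  ext w
  simp [minReps]

theorem minReps_singleton (i : B) : cs.minReps (cs.parabolic {i}) {i} = {1} := by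
  ext w
  simp only [minReps, mem_parabolic_singleton, Set.mem_ofPred_eq, Finset.mem_singleton,
    forall_eq, Set.mem_singleton_iff]
  constructor
  · rintro ⟨rfl | rfl, h⟩
    · rfl
    · simp at h
  · rintro rfl
    simp

theorem conjSet_empty (x : W) : cs.conjSet ∅ x = ∅ := by
  simp [conjSet]

/-- `N_L` is the stabilizer of the root `α_i` in the centralizer of `s_i`. -/
theorem mem_complementN_singleton {i : B} {w : W} :
    w ∈ cs.complementN {i} ↔ Commute w (cs.simple i) ∧ cs.rootSign i w = 1 := by
  have h : cs.conjSet {i} w = cs.simple '' (({i} : Finset B) : Set B) ↔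
      Commute w (cs.simple i) := by
    simp only [conjSet, Finset.coe_singleton, Set.image_singleton, Set.singleton_eq_singleton_iff]
    rw [mul_assoc, inv_mul_eq_iff_eq_mul]
    exact eq_comm
  simp only [complementN, Set.mem_ofPred_eq, h, minReps, Subgroup.mem_top, true_and,
    Finset.mem_singleton, forall_eq]
  exact ⟨fun h => ⟨h.2, cs.rootSign_eq_one_of_length_lt h.2 h.1⟩,
    fun h => ⟨cs.length_lt_of_rootSign_eq_one h.1 h.2, h.1⟩⟩

section TopComponent

variable [Fintype W]

/-- The generator `(∑_{n ∈ N_L} n) e_L` of `topModule`. -/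
noncomputable def topGen (L : Finset B) : MonoidAlgebra ℂ W :=
  open scoped Classical in
  (∑ n : W with n ∈ cs.complementN L, MonoidAlgebra.of ℂ W n) * cs.eElt L L

theorem topModule_eq_span_topGen {L : Finset B} {c : W → ℂ}
    (h : ∀ w ∈ cs.parNormalizer L, cs.topGen L * MonoidAlgebra.of ℂ W w = c w • cs.topGen L) :
    cs.topModule L = Submodule.span ℂ {cs.topGen L} := by
  apply le_antisymm
  · refine Submodule.span_le.mpr ?_
    rintro _ ⟨w, hw, rfl⟩
    exact Submodule.mem_span_singleton.mpr ⟨c w, (h w hw).symm⟩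
  · refine (Submodule.span_singleton_le_iff_mem _ _).mpr (Submodule.subset_span ⟨1, one_mem _, ?_⟩)
    rw [map_one, mul_one]
    rfl

theorem PhiTilde_eq {L : Finset B} {c : W → ℂ} (h0 : cs.topGen L ≠ 0)
    (h : ∀ w ∈ cs.parNormalizer L, cs.topGen L * MonoidAlgebra.of ℂ W w = c w • cs.topGen L)
    (w : cs.parNormalizer L) : cs.PhiTilde L w = c w :=
  LinearMap.trace_restrict_span_singleton h0 (cs.topModule_eq_span_topGen h) _ _ (h w w.2)

theorem xElt_eq_sum_of_minReps_eq {L K : Finset B} {s : Finset W}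
    (h : cs.minReps (cs.parabolic L) K = s) :
    cs.xElt L K = ∑ x ∈ s, MonoidAlgebra.of ℂ W x⁻¹ := by
  rw [xElt]
  congr 1
  ext x
  simp [h]

theorem eElt_empty_empty : cs.eElt ∅ ∅ = 1 := by
  have h := cs.xElt_eq_sum (Finset.Subset.refl ∅)
  have hm : cs.mCoeff ∅ ∅ ∅ = 1 := by
    simp [mCoeff, minReps_empty, parabolic_empty, conjSet_empty]
  have hx : cs.xElt ∅ ∅ = 1 := by
    rw [cs.xElt_eq_sum_of_minReps_eq (s := {1}) (by simp [minReps_empty, parabolic_empty])]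
    simp [MonoidAlgebra.one_def]
  simpa [hm, hx] using h.symm

theorem eElt_singleton (i : B) :
    cs.eElt {i} {i} = (2 : ℂ)⁻¹ • (1 - MonoidAlgebra.of ℂ W (cs.simple i)) := by
  classical
  have hne := (cs.simple_ne_one i).symm
  have hpar : (cs.parabolic {i} : Set W) = {1, cs.simple i} := by
    ext w
    exact cs.mem_parabolic_singleton
  have h1 := cs.xElt_eq_sum (Finset.Subset.refl {i})
  have h2 := cs.xElt_eq_sum (Finset.empty_subset {i})
  have hm1 : cs.mCoeff {i} {i} {i} = 1 := by
    rw [mCoeff, if_pos (Finset.Subset.refl _), minReps_singleton, Set.ncard_eq_one]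
    refine ⟨1, ?_⟩
    ext x
    simp only [Set.mem_ofPred_eq, Set.mem_singleton_iff, and_self_left]
    exact ⟨fun h => h.1, fun h => ⟨h, by simp [h, conjSet]⟩⟩
  have hm2 : cs.mCoeff {i} {i} ∅ = 1 := by
    rw [mCoeff, if_pos (Finset.empty_subset _), minReps_singleton, Set.ncard_eq_one]
    refine ⟨1, ?_⟩
    ext x
    simp only [minReps_empty, conjSet_empty, Set.mem_ofPred_eq, Set.mem_singleton_iff,
      Set.empty_subset, and_true, SetLike.mem_coe]
    exact ⟨fun h => h.1, fun h => ⟨h, h ▸ one_mem _⟩⟩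
  have hm3 : cs.mCoeff {i} ∅ ∅ = 2 := by
    rw [mCoeff, if_pos (Finset.empty_subset _)]
    simp only [minReps_empty, conjSet_empty, Set.empty_subset, and_true, and_self,
      Set.ofPred_mem_eq]
    rw [hpar, Set.ncard_pair hne]
  have hx1 : cs.xElt {i} {i} = 1 := by
    rw [cs.xElt_eq_sum_of_minReps_eq (s := {1}) (by simp [minReps_singleton])]
    simp [MonoidAlgebra.one_def]
  have hx2 : cs.xElt {i} ∅ = 1 + MonoidAlgebra.of ℂ W (cs.simple i) := by
    rw [cs.xElt_eq_sum_of_minReps_eq (s := {1, cs.simple i}) (by simp [minReps_empty, hpar]),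
      Finset.sum_pair hne]
    simp [MonoidAlgebra.one_def]
  have hp : ({i} : Finset B).powerset = {∅, {i}} := by
    ext J
    simp [Finset.subset_singleton_iff]
  rw [hx1, hp, Finset.sum_pair (Finset.singleton_ne_empty i).symm, hm1, hm2] at h1
  rw [hx2, Finset.powerset_empty, Finset.sum_singleton, hm3] at h2
  push_cast at h1 h2
  linear_combination (norm := module) (-1 : ℂ) • h1 + (2⁻¹ : ℂ) • h2

theorem topGen_empty_mul (w : W) :
    cs.topGen ∅ * MonoidAlgebra.of ℂ W w = (1 : ℂ) • cs.topGen ∅ := by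
  have h : ∀ n : W, n ∈ cs.complementN ∅ := fun n => by
    simp [complementN, minReps_empty, conjSet_empty]
  simp only [topGen, h, eElt_empty_empty, mul_one, one_smul, Finset.filter_true, Finset.sum_mul,
    ← map_mul]
  exact Fintype.sum_equiv (Equiv.mulRight w) _ _ fun n => rfl

theorem topGen_empty_ne_zero : cs.topGen ∅ ≠ 0 := by
  have h : ∀ n : W, n ∈ cs.complementN ∅ := fun n => by
    simp [complementN, minReps_empty, conjSet_empty]
  intro h0
  have h1 := congrArg (fun x : MonoidAlgebra ℂ W => x.coeff 1) h0
  simp [topGen, h, eElt_empty_empty] at h1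

theorem topGen_singleton_mul {i : B} {w : W} (hw : Commute w (cs.simple i)) :
    cs.topGen {i} * MonoidAlgebra.of ℂ W w = (cs.rootSign i w : ℂ) • cs.topGen {i} := by
  have key : ∀ u : W, Commute u (cs.simple i) → cs.rootSign i u = 1 →
      cs.topGen {i} * MonoidAlgebra.of ℂ W u = cs.topGen {i} := by
    intro u hu h1
    have he : cs.eElt {i} {i} * MonoidAlgebra.of ℂ W u =
        MonoidAlgebra.of ℂ W u * cs.eElt {i} {i} := by
      rw [eElt_singleton, smul_mul_assoc, mul_smul_comm, sub_mul, mul_sub, ← map_mul, ← map_mul,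
        hu.eq, one_mul, mul_one]
    rw [topGen, mul_assoc, he, ← mul_assoc, Finset.sum_mul]
    congr 1
    refine Finset.sum_equiv (Equiv.mulRight u) (fun n => ?_) (fun n _ => by simp)
    simp only [Finset.mem_filter, Finset.mem_univ, true_and, Equiv.coe_mulRight,
      mem_complementN_singleton]
    constructor
    · rintro ⟨hn, hn1⟩
      exact ⟨hn.mul_left hu, by rw [rootSign_mul cs _ hu, hn1, h1, one_mul]⟩
    · rintro ⟨hn, hn1⟩
      refine ⟨by simpa using hn.mul_left hu.inv_left, ?_⟩
      rwa [rootSign_mul cs _ hu, h1, mul_one] at hn1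
  -- an element of sign `-1` is `s_i` times one of sign `1`, and `(1 - s_i) s_i = -(1 - s_i)`
  have hs : cs.topGen {i} * MonoidAlgebra.of ℂ W (cs.simple i) = -cs.topGen {i} := by
    have he : cs.eElt {i} {i} * MonoidAlgebra.of ℂ W (cs.simple i) = -cs.eElt {i} {i} := by
      rw [eElt_singleton, smul_mul_assoc, sub_mul, ← map_mul, simple_mul_simple_self, map_one,
        one_mul]
      module
    rw [topGen, mul_assoc, he, mul_neg]
  rcases mul_self_eq_one_iff.mp (cs.rootSign_mul_self hw) with h1 | h1
  · rw [key w hw h1, h1, Complex.ofReal_one, one_smul]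
  · have h2 := key (cs.simple i * w) ((Commute.refl _).mul_left hw) (by
      rw [rootSign_mul cs _ hw, rootSign_simple, h1]; norm_num)
    rw [map_mul, ← mul_assoc, hs, neg_mul] at h2
    rw [h1, neg_eq_iff_eq_neg.mp h2, Complex.ofReal_neg, Complex.ofReal_one, neg_one_smul]

/-- The coefficient at `1` does not vanish, as `1` lies in `N_L`, but `s_i` does not. -/
theorem topGen_singleton_ne_zero (i : B) : cs.topGen {i} ≠ 0 := by
  classical
  intro h0
  have hs : cs.simple i ∉ cs.complementN {i} := fun h => by
    have := (cs.mem_complementN_singleton.mp h).2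
    rw [rootSign_simple] at this
    norm_num at this
  have h1 : (1 : W) ∈ cs.complementN {i} :=
    cs.mem_complementN_singleton.mpr ⟨Commute.one_left _, cs.rootSign_one i⟩
  have h2 := congrArg (fun x : MonoidAlgebra ℂ W => x.coeff 1) h0
  have h3 : ∀ n : W, n * cs.simple i = 1 ↔ n = cs.simple i := fun n => by
    rw [mul_eq_one_iff_eq_inv, inv_simple]
  simp [topGen, eElt_singleton, mul_sub, Finset.sum_mul, MonoidAlgebra.single_mul_single,
    Finsupp.single_apply, h3, hs, h1] at h2

end TopComponent

/-! ### The Orlik-Solomon algebra in degrees zero and one -/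

theorem interHyp_nil : cs.interHyp [] = ⊤ := by
  simp [interHyp]

theorem mem_interHyp_singleton {t : cs.Refl} {v : B →₀ ℝ} :
    v ∈ cs.interHyp [t] ↔ cs.reflRep (t : W) v = v := by
  simp [interHyp]

theorem interHyp_pair (t t' : cs.Refl) :
    cs.interHyp [t, t'] = cs.interHyp [t] ⊓ cs.interHyp [t'] := by
  simp [interHyp, iInf_or, iInf_inf_eq]

/-- The simple reflection `s_i`, as an element of `T`. -/
def simpleReflection (i : B) : cs.Refl := ⟨cs.simple i, cs.isReflection_simple i⟩

theorem interHyp_simple (i : B) : cs.interHyp [cs.simpleReflection i] = simpleHyp M i := by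
  ext v
  rw [mem_interHyp_singleton, ← cs.reflRep_simple_eq_self_iff]
  rfl

theorem interHyp_singleton_ne_top [Finite B] (t : cs.Refl) : cs.interHyp [t] ≠ ⊤ := by
  intro h
  have h1 : (cs.reflRep (t : W)).toLinearMap = LinearMap.id := by
    ext1 v
    ext1
    exact cs.mem_interHyp_singleton.mp (h ▸ Submodule.mem_top)
  have h2 := cs.det_reflRep (t : W)
  rw [h1, LinearMap.det_id, t.2.odd_length.neg_one_pow] at h2
  norm_num at h2

open DualNumber in
/-- The homomorphism from the Orlik-Solomon algebra to the dual numbers that sends every generator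
to `ε`.  It shows that `1` and the generators are not zero. -/
noncomputable def osToDualNumber [Finite B] : cs.OrlikSolomon →ₐ[ℂ] DualNumber ℂ :=
  RingQuot.liftAlgHom ℂ ⟨FreeAlgebra.lift ℂ fun _ => ε, by
    intro x y hxy
    induction hxy with
    | anticomm t t' => simp
    | dependent l hl =>
      match l with
      | [] => simp
      -- a single hyperplane is independent, so the relation `1 = 0` does not occur
      | [t] =>
        have := Submodule.finrank_lt (cs.interHyp_singleton_ne_top t)
        simp only [List.length_singleton] at hl
        omega
      | [t, t'] => simp [Finset.sum_range_succ]
      -- all terms are products of at least two generators, and `ε ^ 2 = 0`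
      | t :: t' :: t'' :: l =>
        rw [map_sum, map_zero]
        refine Finset.sum_eq_zero fun i hi => ?_
        have h : ∀ l' : List cs.Refl, 2 ≤ l'.length →
            FreeAlgebra.lift ℂ (fun _ => (ε : DualNumber ℂ)) (l'.map (FreeAlgebra.ι ℂ)).prod = 0 := by
          intro l' hl'
          obtain ⟨k, hk⟩ := Nat.exists_eq_add_of_le hl'
          rw [map_list_prod, List.map_map, List.prod_eq_pow_card _ ε (by simp), List.length_map,
            hk, pow_add, DualNumber.eps_pow_two, zero_mul]
        rw [map_smul, h _ (by
          rw [List.length_eraseIdx_of_lt (Finset.mem_range.mp hi)]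
          simp), smul_zero]⟩

theorem osToDualNumber_osGen [Finite B] (t : cs.Refl) :
    cs.osToDualNumber (cs.osGen t) = DualNumber.eps := by
  simp [osToDualNumber, osGen]

theorem one_ne_zero_orlikSolomon [Finite B] : (1 : cs.OrlikSolomon) ≠ 0 := fun h => by
  have := congrArg cs.osToDualNumber h
  rw [map_one, map_zero] at this
  exact one_ne_zero this

theorem osGen_ne_zero [Finite B] (t : cs.Refl) : cs.osGen t ≠ 0 := fun h => by
  have := congrArg (fun x => TrivSqZeroExt.snd (cs.osToDualNumber x)) h
  simp [osToDualNumber_osGen] at this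

/-- Generators with the same hyperplane are equal: the defining relation of the dependent pair
`t, t'` is `a_t - a_t' = 0`. -/
theorem osGen_eq_of_interHyp_eq [Finite B] {t t' : cs.Refl}
    (h : cs.interHyp [t] = cs.interHyp [t'])
    (hd : Module.finrank ℝ (cs.interHyp [t]) + 1 = Module.finrank ℝ (B →₀ ℝ)) :
    cs.osGen t = cs.osGen t' := by
  have hrel := RingQuot.mkAlgHom_rel ℂ (OSRel.dependent (cs := cs) [t, t'] (by
    rw [interHyp_pair, ← h, inf_idem, ← hd]
    simp))
  simp only [List.length_cons, List.length_nil, Finset.sum_range_succ, Finset.sum_range_zero,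
    map_zero] at hrel
  simp only [List.eraseIdx, List.map, List.prod_cons, List.prod_nil, mul_one, map_add, map_smul,
    map_zero] at hrel
  change (0 : cs.OrlikSolomon) + (-1 : ℂ) ^ (0 + 1) • cs.osGen t' +
    (-1 : ℂ) ^ (0 + 1 + 1) • cs.osGen t = 0 at hrel
  have h2 : cs.osGen t - cs.osGen t' = 0 := by
    rw [← hrel]
    module
  exact sub_eq_zero.mp h2

theorem osComponent_top : cs.osComponent ⊤ = Submodule.span ℂ {1} := by
  rw [osComponent]
  congr 1
  ext a
  simp only [finrank_top, Nat.add_eq_right, List.length_eq_zero_iff, Set.mem_ofPred_eq,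
    Set.mem_singleton_iff]
  constructor
  · rintro ⟨l, rfl, -, rfl⟩
    simp
  · rintro rfl
    exact ⟨[], rfl, cs.interHyp_nil, by simp⟩

theorem osComponent_simpleHyp [Finite B] (i : B) :
    cs.osComponent (simpleHyp M i) = Submodule.span ℂ {cs.osGen (cs.simpleReflection i)} := by
  have hd : 1 + Module.finrank ℝ (simpleHyp M i) = Module.finrank ℝ (B →₀ ℝ) := by
    rw [← finrank_quotient_simpleHyp i]
    exact (simpleHyp M i).finrank_quotient_add_finrank
  rw [osComponent]
  congr 1
  ext a
  simp only [Set.mem_ofPred_eq, Set.mem_singleton_iff]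
  constructor
  · rintro ⟨l, hl, hX, rfl⟩
    obtain ⟨t, rfl⟩ := List.length_eq_one_iff.mp (show l.length = 1 by omega)
    rw [List.map_singleton, List.prod_singleton]
    exact cs.osGen_eq_of_interHyp_eq (by rw [hX, interHyp_simple]) (by rw [hX, add_comm, hd])
  · rintro rfl
    exact ⟨[cs.simpleReflection i], hd, cs.interHyp_simple i, by simp⟩

theorem PsiTilde_empty [Finite B] (w : cs.parNormalizer ∅) : cs.PsiTilde ∅ w = 1 :=
  LinearMap.trace_restrict_span_singleton cs.one_ne_zero_orlikSolomon
    (by rw [fixSpace_empty, osComponent_top]) _ _ (by simp)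

theorem PsiTilde_singleton [Finite B] {i : B} (w : cs.parNormalizer {i}) :
    cs.PsiTilde {i} w = 1 := by
  refine LinearMap.trace_restrict_span_singleton (cs.osGen_ne_zero (cs.simpleReflection i))
    (by rw [fixSpace_singleton, osComponent_simpleHyp]) _ _ ?_
  have h : cs.reflConj (w : W) (cs.simpleReflection i) = cs.simpleReflection i := by
    apply Subtype.ext
    change (w : W)⁻¹ * cs.simple i * w = cs.simple i
    rw [mul_assoc, inv_mul_eq_iff_eq_mul]
    exact (cs.mem_parNormalizer_singleton.mp w.2).eq.symm
  rw [AlgHom.toLinearMap_apply, osAct_osGen, h, one_smul]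

end CoxeterSystem

/-! ### Induction from the whole group, and conclusion -/

theorem inducedFun_of_eq {G : Type*} [Group G] [Fintype G] {H K : Subgroup G} (hHK : H ≤ K)
    (h : H = K) (φ : H →* ℂˣ) (g : K) :
    inducedFun H K hHK (fun x => (φ x : ℂ)) g = φ ⟨g, h ▸ g.2⟩ := by
  classical
  subst h
  have h1 : ∀ x : H, (if hx : (x * g * x⁻¹ : G) ∈ H then (φ ⟨x * g * x⁻¹, hx⟩ : ℂ) else 0) =
      φ g := by
    intro x
    have hx : (x * g * x⁻¹ : G) ∈ H := (x * g * x⁻¹).2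
    rw [dif_pos hx]
    have h2 : φ (x * g * x⁻¹) = φ g := by
      rw [map_mul, map_mul, map_inv, mul_right_comm, mul_inv_cancel, one_mul]
    exact congrArg Units.val h2
  have hc : (Nat.card H : ℂ) ≠ 0 := by exact_mod_cast Nat.card_pos.ne'
  rw [inducedFun]
  simp only [h1]
  rw [Finset.sum_const, Finset.card_univ, nsmul_eq_mul, ← Nat.card_eq_fintype_card,
    inv_mul_cancel_left₀ hc]

namespace CoxeterSystem

variable {B W : Type*} [Group W] {M : CoxeterMatrix B} (cs : CoxeterSystem M W)

/-- If `W_L` has a single cuspidal class, whose representative has centralizer `N_W(W_L)`, then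
the induced characters are the characters themselves. -/
theorem exists_characters_of_unique_class [Finite B] [Fintype W] {L : Finset B}
    (rep : cs.CuspidalClass L → cs.parabolic L) (C₀ : cs.CuspidalClass L)
    (hC₀ : ∀ C, C = C₀)
    (hN : ∀ C, Subgroup.centralizer {(rep C : W)} = cs.parNormalizer L)
    (χ : cs.parNormalizer L →* ℂˣ) (hΦ : ∀ g, cs.PhiTilde L g = χ g)
    (hΨ : ∀ g, cs.PsiTilde L g = 1)
    (hα : ∀ g : cs.parNormalizer L, (χ g : ℂ) * cs.signChar (g : W) * cs.alphaChar L g = 1) :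
    ∃ (hC : ∀ C, Subgroup.centralizer {(rep C : W)} ≤ cs.parNormalizer L)
      (φ ψ : ∀ C, Subgroup.centralizer {(rep C : W)} →* ℂˣ),
      (∀ g : cs.parNormalizer L, cs.PhiTilde L g =
        ∑ C, inducedFun (Subgroup.centralizer {(rep C : W)}) (cs.parNormalizer L) (hC C)
          (fun c => (φ C c : ℂ)) g) ∧
      (∀ g : cs.parNormalizer L, cs.PsiTilde L g =
        ∑ C, inducedFun (Subgroup.centralizer {(rep C : W)}) (cs.parNormalizer L) (hC C)
          (fun c => (ψ C c : ℂ)) g) ∧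
      (∀ C, ∀ c : Subgroup.centralizer {(rep C : W)}, (ψ C c : ℂ) =
        φ C c * cs.signChar c * cs.alphaChar L ⟨c, hC C c.2⟩) := by
  refine ⟨fun C => (hN C).le, fun C => χ.comp (Subgroup.inclusion (hN C).le), fun _ => 1,
    fun g => ?_, fun g => ?_, fun C c => ?_⟩
  · rw [Fintype.sum_eq_single C₀ fun C hC => absurd (hC₀ C) hC, inducedFun_of_eq _ (hN C₀), hΦ]
    rfl
  · rw [Fintype.sum_eq_single C₀ fun C hC => absurd (hC₀ C) hC, inducedFun_of_eq _ (hN C₀), hΨ]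
    rfl
  · exact (hα ⟨c, (hN C).le c.2⟩).symm

theorem coe_eq_simple_of_mk_eq_cuspidalClass [Finite W] {i : B} (C : cs.CuspidalClass {i})
    {w : cs.parabolic {i}} (hw : ConjClasses.mk w = C.1) : (w : W) = cs.simple i := by
  obtain ⟨u, hu, hcusp⟩ := C.2
  rw [isCuspidal_singleton_iff] at hcusp
  refine (cs.mem_parabolic_singleton.mp w.2).resolve_left fun h1 => ?_
  have h2 : IsConj w u := ConjClasses.mk_eq_mk_iff_isConj.mp (hw.trans hu.symm)
  rw [show w = 1 from Subtype.ext h1, isConj_one_right] at h2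
  rw [h2] at hcusp
  exact cs.simple_ne_one i hcusp.symm

end CoxeterSystem

theorem mainTheorem6 {B W : Type*} [Finite B] [Group W] [Fintype W] {M : CoxeterMatrix B}
    (cs : CoxeterSystem M W) (L : Finset B) (hL : L.card ≤ 1)
    (rep : cs.CuspidalClass L → cs.parabolic L)
    (hrep : ∀ C, ConjClasses.mk (rep C) = C.1) :
    ∃ (hC : ∀ C, Subgroup.centralizer {(rep C : W)} ≤ cs.parNormalizer L)
      (φ ψ : ∀ C, Subgroup.centralizer {(rep C : W)} →* ℂˣ),
      (∀ g : cs.parNormalizer L, cs.PhiTilde L g =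
        ∑ C, inducedFun (Subgroup.centralizer {(rep C : W)}) (cs.parNormalizer L) (hC C)
          (fun c => (φ C c : ℂ)) g) ∧
      (∀ g : cs.parNormalizer L, cs.PsiTilde L g =
        ∑ C, inducedFun (Subgroup.centralizer {(rep C : W)}) (cs.parNormalizer L) (hC C)
          (fun c => (ψ C c : ℂ)) g) ∧
      (∀ C, ∀ c : Subgroup.centralizer {(rep C : W)}, (ψ C c : ℂ) =
        φ C c * cs.signChar c * cs.alphaChar L ⟨c, hC C c.2⟩) := by
  rcases Finset.eq_empty_or_nonempty L with rfl | hne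
  · have h1 : ∀ w : cs.parabolic ∅, w = 1 := fun w =>
      Subtype.ext (Subgroup.mem_bot.mp (cs.parabolic_empty ▸ w.2))
    refine cs.exists_characters_of_unique_class rep
      ⟨ConjClasses.mk 1, 1, rfl, cs.isCuspidal_empty 1⟩
      (fun C => Subtype.ext ?_) (fun C => ?_) 1
      (cs.PhiTilde_eq (c := fun _ => 1) cs.topGen_empty_ne_zero fun w _ => cs.topGen_empty_mul w)
      cs.PsiTilde_empty fun g => ?_
    · rw [← hrep C, h1 (rep C)]
    · rw [h1 (rep C), cs.parNormalizer_empty]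
      ext w
      simp [Subgroup.mem_centralizer_singleton_iff]
    · rw [cs.alphaChar_empty, MonoidHom.one_apply, Units.val_one, one_mul, cs.signChar_mul_self]
  · obtain ⟨i, rfl⟩ := Finset.card_eq_one.mp (le_antisymm hL hne.card_pos)
    have hmem : cs.simple i ∈ cs.parabolic {i} := cs.mem_parabolic_singleton.mpr (Or.inr rfl)
    refine cs.exists_characters_of_unique_class rep
      ⟨ConjClasses.mk ⟨cs.simple i, hmem⟩, _, rfl, (cs.isCuspidal_singleton_iff _).mpr rfl⟩
      (fun C => Subtype.ext ?_) (fun C => ?_)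
      ((cs.rootSignHom i).comp (Subgroup.inclusion (cs.centralizer_simple i).ge))
      (cs.PhiTilde_eq (cs.topGen_singleton_ne_zero i) fun w hw =>
        cs.topGen_singleton_mul (cs.mem_parNormalizer_singleton.mp hw))
      cs.PsiTilde_singleton fun g => ?_
    · rw [← hrep C]
      exact congrArg _ (Subtype.ext (cs.coe_eq_simple_of_mk_eq_cuspidalClass C (hrep C)))
    · rw [cs.coe_eq_simple_of_mk_eq_cuspidalClass C (hrep C), cs.centralizer_simple]
    · change (cs.rootSign i (g : W) : ℂ) * _ * _ = 1
      rw [mul_right_comm, mul_comm (cs.rootSign i (g : W) : ℂ),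
        cs.alphaChar_singleton_mul_rootSign, cs.signChar_mul_self]
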